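/- There is an absolute constant $C>0$ such that the following holds. Let $n\ge 1$, let $\mu=(\mu_1,\dots,\mu_n)\in[0,1]^n$ be arbitrary (not necessarily monotone), and let $y_1,\dots,y_n$ be independent random variables such that $y_i$ has the Bernoulli distribution on $\{0,1\}$ with mean $\mu_i$. Let $$\mathcal M_n(0,1)=\{u\in\mathbb R^n : 0\le u_1\le\dots\le u_n\le 1\},$$ let $\|\cdot\|$ be the Euclidean norm on $\mathbb R^n$, and let $$\hat\mu=\operatorname*{arg\,min}_{u\in\mathcal M_n(0,1)}\|y-u\|^2$$ be the least squares estimator over $\mathcal M_n(0,1)$ based on $y=(y_1,\dots,y_n)$. Then for every $x\ge 0$, with probability at least $1-e^{-x}$, $$\frac1n\|\hat\mu-\mu\|^2\le \min_{u\in\mathcal M_n(0,1)}\frac1n\|u-\mu\|^2+\left(\left(\frac Cn\right)^{1/3}+\sqrt{\frac{2x}{n}}\right)^2 .$$ -/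

import Mathlib

open MeasureTheory ProbabilityTheory

/-- The truncated isotonic cone `M_n(a, b) = {u ∈ ℝⁿ | a ≤ u₁ ≤ ⋯ ≤ uₙ ≤ b}`, as a subset of
Euclidean space. -/
def isotonicBox (n : ℕ) (a b : ℝ) : Set (EuclideanSpace ℝ (Fin n)) :=
  {u | Monotone (fun i => u i) ∧ ∀ i, a ≤ u i ∧ u i ≤ b}

/-- `v` is the least squares estimate in `K` for the observation `y`:
`v ∈ argmin_{u ∈ K} ‖y - u‖²`. -/
def IsLeastSquares {n : ℕ} (K : Set (EuclideanSpace ℝ (Fin n)))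
    (y v : EuclideanSpace ℝ (Fin n)) : Prop :=
  v ∈ K ∧ IsMinOn (fun u => ‖y - u‖ ^ 2) K v

theorem isotonicBox_nonempty (n : ℕ) : (isotonicBox n 0 1).Nonempty :=
  ⟨0, by intro i j _; simp, by intro i; simp⟩

theorem isotonicBox_convex (n : ℕ) (a b : ℝ) : Convex ℝ (isotonicBox n a b) := by
  rintro u ⟨hu, hu'⟩ v ⟨hv, hv'⟩ s t hs ht hst
  refine ⟨fun i j hij => ?_, fun i => ?_⟩
  · have h1 := mul_le_mul_of_nonneg_left (hu hij) hs
    have h2 := mul_le_mul_of_nonneg_left (hv hij) ht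
    simpa using add_le_add h1 h2
  · have h1 := mul_le_mul_of_nonneg_left (hu' i).1 hs
    have h2 := mul_le_mul_of_nonneg_left (hv' i).1 ht
    have h3 := mul_le_mul_of_nonneg_left (hu' i).2 hs
    have h4 := mul_le_mul_of_nonneg_left (hv' i).2 ht
    have ha : s * a + t * a = a := by rw [← add_mul, hst, one_mul]
    have hb : s * b + t * b = b := by rw [← add_mul, hst, one_mul]
    simp only [PiLp.add_apply, PiLp.smul_apply, smul_eq_mul]
    constructor <;> linarith

theorem isotonicBox_isClosed (n : ℕ) (a b : ℝ) : IsClosed (isotonicBox n a b) := by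
  have h : isotonicBox n a b =
      (⋂ i, ⋂ j, ⋂ (_ : i ≤ j), {u : EuclideanSpace ℝ (Fin n) | u i ≤ u j}) ∩
        ⋂ i, ({u : EuclideanSpace ℝ (Fin n) | a ≤ u i} ∩
          {u : EuclideanSpace ℝ (Fin n) | u i ≤ b}) := by
    ext u
    simp [isotonicBox, Monotone]
  rw [h]
  refine IsClosed.inter ?_ ?_
  · exact isClosed_iInter fun i => isClosed_iInter fun j => isClosed_iInter fun _ =>
      isClosed_le (by fun_prop) (by fun_prop)
  · exact isClosed_iInter fun i =>
      (isClosed_le (by fun_prop) (by fun_prop)).inter (isClosed_le (by fun_prop) (by fun_prop))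

/-- The least squares estimate over `M_n(0, 1)` exists and is unique for every observation. -/
theorem existsUnique_isLeastSquares (n : ℕ) (y : EuclideanSpace ℝ (Fin n)) :
    ∃! v, IsLeastSquares (isotonicBox n 0 1) y v := by
  have hc := isotonicBox_convex n 0 1
  obtain ⟨v, hv, hmin⟩ := (isotonicBox_isClosed n 0 1).exists_infDist_eq_dist
    (isotonicBox_nonempty n) y
  refine ⟨v, ⟨hv, fun u hu => ?_⟩, ?_⟩
  · have : ‖y - v‖ ≤ ‖y - u‖ := by
      rw [← dist_eq_norm, ← dist_eq_norm, ← hmin]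
      exact Metric.infDist_le_dist_of_mem hu
    exact pow_le_pow_left₀ (norm_nonneg _) this 2
  · rintro w ⟨hw, hwmin⟩
    have hm := hc hv hw (by norm_num : (0 : ℝ) ≤ 1 / 2) (by norm_num : (0 : ℝ) ≤ 1 / 2)
      (by norm_num)
    have h1 : ‖y - w‖ ^ 2 ≤ ‖y - ((1 / 2 : ℝ) • v + (1 / 2 : ℝ) • w)‖ ^ 2 := hwmin hm
    have h2 : ‖y - w‖ ^ 2 ≤ ‖y - v‖ ^ 2 := hwmin hv
    have h3 : ‖y - v‖ ^ 2 ≤ ‖y - w‖ ^ 2 := by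
      have : ‖y - v‖ ≤ ‖y - w‖ := by
        rw [← dist_eq_norm, ← dist_eq_norm, ← hmin]
        exact Metric.infDist_le_dist_of_mem hw
      exact pow_le_pow_left₀ (norm_nonneg _) this 2
    have h4 := parallelogram_law_with_norm ℝ (y - v) (y - w)
    have h5 : y - v + (y - w) = (2 : ℝ) • (y - ((1 / 2 : ℝ) • v + (1 / 2 : ℝ) • w)) := by
      module
    have h6 : y - v - (y - w) = w - v := by abel
    rw [h5, h6, norm_smul, Real.norm_ofNat] at h4
    have h7 : ‖w - v‖ = 0 := by
      have := sq_nonneg ‖w - v‖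
      have : ‖w - v‖ * ‖w - v‖ ≤ 0 := by nlinarith
      nlinarith [norm_nonneg (w - v), mul_self_nonneg ‖w - v‖,
        mul_self_eq_zero.1 (le_antisymm this (mul_self_nonneg _))]
    exact sub_eq_zero.1 (norm_eq_zero.1 h7)

/-- The smallest approximation error `min_{u ∈ M_n(0, 1)} (1/n) ‖u - μ‖²` of the vector `μ`
by the model `M_n(0, 1)`. -/
noncomputable def minApproxError {n : ℕ} (μ : EuclideanSpace ℝ (Fin n)) : ℝ :=
  sInf ((fun u => (1 / (n : ℝ)) * ‖u - μ‖ ^ 2) '' isotonicBox n 0 1)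

/-- The infimum in `minApproxError` is an attained minimum. -/
theorem minApproxError_isLeast {n : ℕ} (μ : EuclideanSpace ℝ (Fin n)) :
    IsLeast ((fun u => (1 / (n : ℝ)) * ‖u - μ‖ ^ 2) '' isotonicBox n 0 1) (minApproxError μ) := by
  obtain ⟨v, ⟨hv, hmin⟩, -⟩ := existsUnique_isLeastSquares n μ
  have h : IsLeast ((fun u => (1 / (n : ℝ)) * ‖u - μ‖ ^ 2) '' isotonicBox n 0 1)
      ((1 / (n : ℝ)) * ‖v - μ‖ ^ 2) := by
    refine ⟨⟨v, hv, rfl⟩, ?_⟩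
    rintro _ ⟨u, hu, rfl⟩
    have h1 : ‖μ - v‖ ^ 2 ≤ ‖μ - u‖ ^ 2 := hmin hu
    rw [norm_sub_rev μ v, norm_sub_rev μ u] at h1
    exact mul_le_mul_of_nonneg_left h1 (by positivity)
  have h2 : minApproxError μ = (1 / (n : ℝ)) * ‖v - μ‖ ^ 2 := h.csInf_eq
  rw [h2]
  exact h

/-! Let `u` be the best approximation of `μ` in the box and `ξ = y - μ`. Convexity gives `‖μhat -
μ‖² ≤ ‖u - μ‖² + 2⟨ξ, μhat - u⟩ - ‖μhat - u‖²` (`IsLeastSquares.norm_sub_sq_le`). If `⟨ξ, w - u⟩ ≤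
t²/2 + t√(2x)` for all `w` in the box within `t` of `u`, scaling towards `u` bounds the excess by
`(t + √(2x))²` (`two_mul_inner_sub_sq_le`). It remains to control the localized supremum for `t` of
order `n^(1/6)`.

Concentration: the supremum is a convex `t`-Lipschitz function of the noise. The weak transport
inequality `bernoulliExp_exp_le`, proved for one coin and tensorized, yields the upper tail `e^{-x}`
at deviation `t√(2x)` (`bernoulliExp_supportFun_tail`).

Expectation: `bernoulliExp_supportFun_le` expands `⟨ξ, w - u⟩` in a Haar system. Monotonicity bounds
the `ℓ¹` norm of the detail coefficients of `w - u` at each level, and the localization bounds their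
`ℓ²` norm. Noise coefficients are split at a level-dependent threshold: the part below is paired
with the `ℓ¹` bound, the excess with the `ℓ²` bound. Stopping at blocks of length about `n^(2/3)`
makes the width at most `t²/2` (`exists_critical_radius`). -/

/-! ### Expectation under a finite product of Bernoulli distributions. -/

/-- The probability of the outcome `b` of independent coin tosses with success probabilities
`p i`. -/
noncomputable def bernoulliWeight {n : ℕ} (p : Fin n → ℝ) (b : Fin n → Bool) : ℝ :=
  ∏ i, if b i then p i else 1 - p i

/-- The `{0, 1}`-valued vector encoded by `b`. -/
def boolVec {n : ℕ} (b : Fin n → Bool) : Fin n → ℝ := fun i => if b i then 1 else 0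

/-- The expectation of `F` under the product of the Bernoulli distributions with means `p i`. -/
noncomputable def bernoulliExp {n : ℕ} (p : Fin n → ℝ) (F : (Fin n → ℝ) → ℝ) : ℝ :=
  ∑ b, bernoulliWeight p b * F (boolVec b)

section BernoulliExp

variable {n : ℕ} {p : Fin n → ℝ}

theorem bernoulliWeight_nonneg (hp : ∀ i, p i ∈ Set.Icc (0 : ℝ) 1) (b : Fin n → Bool) :
    0 ≤ bernoulliWeight p b := by
  refine Finset.prod_nonneg fun i _ => ?_
  have := hp i
  split_ifs <;> linarith [this.1, this.2]

theorem bernoulliExp_mono (hp : ∀ i, p i ∈ Set.Icc (0 : ℝ) 1) {F G : (Fin n → ℝ) → ℝ}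
    (h : ∀ x, F x ≤ G x) : bernoulliExp p F ≤ bernoulliExp p G :=
  Finset.sum_le_sum fun b _ => mul_le_mul_of_nonneg_left (h _) (bernoulliWeight_nonneg hp b)

theorem bernoulliExp_add (F G : (Fin n → ℝ) → ℝ) :
    bernoulliExp p (fun x => F x + G x) = bernoulliExp p F + bernoulliExp p G := by
  simp only [bernoulliExp, mul_add, Finset.sum_add_distrib]

theorem bernoulliExp_const_mul (c : ℝ) (F : (Fin n → ℝ) → ℝ) :
    bernoulliExp p (fun x => c * F x) = c * bernoulliExp p F := by
  simp only [bernoulliExp, Finset.mul_sum]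
  exact Finset.sum_congr rfl fun b _ => by ring

theorem bernoulliExp_sum {ι : Type*} (s : Finset ι) (F : ι → (Fin n → ℝ) → ℝ) :
    bernoulliExp p (fun x => ∑ k ∈ s, F k x) = ∑ k ∈ s, bernoulliExp p (F k) := by
  simp only [bernoulliExp, Finset.mul_sum]
  exact Finset.sum_comm

theorem bernoulliExp_succ (p : Fin (n + 1) → ℝ) (F : (Fin (n + 1) → ℝ) → ℝ) :
    bernoulliExp p F = (1 - p 0) * bernoulliExp (Fin.tail p) (fun x => F (Fin.cons 0 x)) +
      p 0 * bernoulliExp (Fin.tail p) (fun x => F (Fin.cons 1 x)) := by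
  have key : ∀ (a : Bool) (b : Fin n → Bool),
      boolVec (Fin.cons a b : Fin (n + 1) → Bool) = Fin.cons (if a then 1 else 0) (boolVec b) := by
    intro a b
    funext i
    refine Fin.cases ?_ (fun j => ?_) i <;> simp [boolVec]
  unfold bernoulliExp
  rw [← (Fin.consEquiv fun _ => Bool).sum_comp, Fintype.sum_prod_type, Fintype.sum_bool, add_comm]
  simp only [Fin.consEquiv, Equiv.coe_fn_mk, key, bernoulliWeight, Fin.prod_univ_succ,
    Fin.cons_zero, Fin.cons_succ, Fin.tail, Finset.mul_sum, mul_assoc]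
  simp

theorem sum_bernoulliWeight (p : Fin n → ℝ) : ∑ b, bernoulliWeight p b = 1 := by
  unfold bernoulliWeight
  rw [← Fintype.piFinset_univ,
    ← Finset.prod_univ_sum (fun _ => Finset.univ) fun i (a : Bool) => if a then p i else 1 - p i]
  simp

theorem bernoulliExp_const (c : ℝ) : bernoulliExp p (fun _ => c) = c := by
  simp only [bernoulliExp, ← Finset.sum_mul, sum_bernoulliWeight, one_mul]

theorem bernoulliExp_centered_linear (p c : Fin n → ℝ) :
    bernoulliExp p (fun x => ∑ i, (x i - p i) * c i) = 0 := by
  induction n with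
  | zero => simp [bernoulliExp]
  | succ n ih =>
    have h := ih (Fin.tail p) (Fin.tail c)
    simp only [Fin.tail] at h
    rw [bernoulliExp_succ]
    simp only [Fin.sum_univ_succ, Fin.cons_zero, Fin.cons_succ, bernoulliExp_add,
      bernoulliExp_const] at h ⊢
    rw [h]
    ring

theorem bernoulliExp_sqrt_le (hp : ∀ i, p i ∈ Set.Icc (0 : ℝ) 1) {F : (Fin n → ℝ) → ℝ}
    (hF : ∀ x, 0 ≤ F x) :
    bernoulliExp p (fun x => √(F x)) ≤ √(bernoulliExp p F) :=
  Real.strictConcaveOn_sqrt.concaveOn.le_map_sum (fun b _ => bernoulliWeight_nonneg hp b)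
    (sum_bernoulliWeight p) (fun _ _ => hF _)

end BernoulliExp

/-! ### Weak transport inequality and sub-Gaussian bounds. -/

/-- For `d ≤ 1` the exponent is minimized at `s = 1 - d`, with value `d - d²/2 ≤ 2d/(d + 2) ≤ log (1
+ d)`. For `d ≥ 1`, `s = 0` suffices since `√e ≤ 2`. -/
theorem exists_exp_le_one_add {d : ℝ} (hd : 0 ≤ d) :
    ∃ s ∈ Set.Icc (0 : ℝ) 1, Real.exp (s * d + (1 - s) ^ 2 / 2) ≤ 1 + d := by
  rcases le_total d 1 with h | h
  · refine ⟨1 - d, ⟨by linarith, by linarith⟩, ?_⟩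
    rw [← Real.le_log_iff_exp_le (by linarith)]
    refine le_trans ?_ (Real.le_log_one_add_of_nonneg hd)
    rw [le_div_iff₀ (by linarith)]
    nlinarith [pow_nonneg hd 3]
  · refine ⟨0, by simp, ?_⟩
    have h1 : Real.exp (0 * d + (1 - 0) ^ 2 / 2) ^ 2 ≤ 2 ^ 2 := by
      rw [← Real.exp_nat_mul]
      norm_num
      linarith [Real.exp_one_lt_d9]
    exact (abs_le_of_sq_le_sq' h1 (by norm_num)).2.trans (by linarith)

/-- The weak transport inequality for one Bernoulli variable. -/
theorem two_point_transport {q a b X₀ X₁ : ℝ} (hq : q ∈ Set.Icc (0 : ℝ) 1)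
    (h₀ : ∀ s ∈ Set.Icc (0 : ℝ) 1, X₀ ≤ Real.exp ((1 - s) * a + s * b + s ^ 2 / 2))
    (h₁ : ∀ s ∈ Set.Icc (0 : ℝ) 1, X₁ ≤ Real.exp ((1 - s) * a + s * b + (1 - s) ^ 2 / 2)) :
    (1 - q) * X₀ + q * X₁ ≤ Real.exp ((1 - q) * a + q * b) := by
  -- Exchanging the two outcomes reduces to `a ≤ b`. The lower point then stays put, only the upper
  -- one moves to an optimal `s`, and `1 + q(b - a) ≤ e^{q(b - a)}` closes the bound.
  have aux : ∀ {q a b X₀ X₁ : ℝ}, q ∈ Set.Icc (0 : ℝ) 1 → a ≤ b → X₀ ≤ Real.exp a →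
      (∀ s ∈ Set.Icc (0 : ℝ) 1, X₁ ≤ Real.exp ((1 - s) * a + s * b + (1 - s) ^ 2 / 2)) →
      (1 - q) * X₀ + q * X₁ ≤ Real.exp ((1 - q) * a + q * b) := by
    intro q a b X₀ X₁ hq hab h₀ h₁
    obtain ⟨s, hs, h⟩ := exists_exp_le_one_add (sub_nonneg.2 hab)
    have h2 : X₁ ≤ Real.exp a * (1 + (b - a)) := by
      refine (h₁ s hs).trans ?_
      rw [show (1 - s) * a + s * b + (1 - s) ^ 2 / 2 = a + (s * (b - a) + (1 - s) ^ 2 / 2) by ring,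
        Real.exp_add]
      exact mul_le_mul_of_nonneg_left h (Real.exp_pos _).le
    have h3 : Real.exp a * (1 + q * (b - a)) ≤ Real.exp ((1 - q) * a + q * b) := by
      rw [show (1 - q) * a + q * b = a + q * (b - a) by ring, Real.exp_add]
      refine mul_le_mul_of_nonneg_left ?_ (Real.exp_pos _).le
      linarith [Real.add_one_le_exp (q * (b - a))]
    have h4 := mul_le_mul_of_nonneg_left h₀ (sub_nonneg.2 hq.2)
    have h5 := mul_le_mul_of_nonneg_left h2 hq.1
    linarith
  rcases le_total a b with hab | hab
  · exact aux hq hab (by simpa using h₀ 0 (by simp)) h₁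
  · have h := aux (q := 1 - q) (X₀ := X₁) (X₁ := X₀) ⟨by linarith [hq.2], by linarith [hq.1]⟩ hab
      (by simpa using h₁ 1 (by simp)) (fun s hs => by
        have h := h₀ (1 - s) ⟨by linarith [hs.2], by linarith [hs.1]⟩
        rwa [show (1 - (1 - s)) * a + (1 - s) * b = (1 - s) * b + s * a by ring] at h)
    rwa [show 1 - (1 - q) = q by ring, add_comm, add_comm (q * b)] at h

/-- The weak transport inequality for products of Bernoulli distributions. -/
theorem bernoulliExp_exp_le {n : ℕ} {p : Fin n → ℝ} (hp : ∀ i, p i ∈ Set.Icc (0 : ℝ) 1)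
    {f g : (Fin n → ℝ) → ℝ} (hf : ConvexOn ℝ Set.univ f)
    (hfg : ∀ x x', g x ≤ f x' + (∑ i, (x i - x' i) ^ 2) / 2) :
    bernoulliExp p (fun x => Real.exp (g x)) ≤ Real.exp (bernoulliExp p f) := by
  induction n with
  | zero =>
    simp only [bernoulliExp, bernoulliWeight, Finset.univ_unique, Finset.sum_singleton,
      Finset.univ_eq_empty, Finset.prod_empty, one_mul, Real.exp_le_exp]
    have h := fun b : Fin 0 → Bool => hfg (boolVec b) (boolVec b)
    simp only [Finset.univ_eq_empty, Finset.sum_empty, zero_div, add_zero] at h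
    exact h _
  | succ n ih =>
    have hp' : ∀ i, Fin.tail p i ∈ Set.Icc (0 : ℝ) 1 := fun i => hp i.succ
    let F : ℝ → ℝ := fun s => bernoulliExp (Fin.tail p) (fun x => f (Fin.cons s x))
    -- The first coordinate is frozen at `δ` in `g` but at an arbitrary real `s` in `f`, at cost `(δ
    -- - s)²/2`. Convexity of `F` then compares `F s` with its chord, which is what the one-coin
    -- inequality asks for.
    have hstep : ∀ δ s : ℝ,
        bernoulliExp (Fin.tail p) (fun x => Real.exp (g (Fin.cons δ x))) ≤
          Real.exp (F s + (δ - s) ^ 2 / 2) := by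
      intro δ s
      have h := ih hp' (f := fun x => f (Fin.cons s x) + (δ - s) ^ 2 / 2)
        (g := fun x => g (Fin.cons δ x)) ?_ ?_
      · rwa [bernoulliExp_add, bernoulliExp_const] at h
      · refine ConvexOn.add ⟨convex_univ, fun x _ y _ a b ha hb hab => ?_⟩
          (convexOn_const _ convex_univ)
        have h := hf.2 (Set.mem_univ (Fin.cons s x : Fin (n + 1) → ℝ))
          (Set.mem_univ (Fin.cons s y)) ha hb hab
        convert h using 2
        funext i
        refine Fin.cases ?_ (fun j => ?_) i
        · simp [← add_mul, hab]
        · simp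
      · intro x x'
        have h := hfg (Fin.cons δ x) (Fin.cons s x')
        rw [Fin.sum_univ_succ] at h
        simp only [Fin.cons_zero, Fin.cons_succ] at h
        linarith
    have hF : ∀ s ∈ Set.Icc (0 : ℝ) 1, F s ≤ (1 - s) * F 0 + s * F 1 := by
      intro s hs
      have h : F s ≤ bernoulliExp (Fin.tail p)
          (fun x => (1 - s) * f (Fin.cons 0 x) + s * f (Fin.cons 1 x)) := by
        refine bernoulliExp_mono hp' fun x => ?_
        have h := hf.2 (Set.mem_univ (Fin.cons 0 x : Fin (n + 1) → ℝ))
          (Set.mem_univ (Fin.cons 1 x)) (sub_nonneg.2 hs.2) hs.1 (by ring)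
        have e : (1 - s) • (Fin.cons 0 x : Fin (n + 1) → ℝ) + s • (Fin.cons 1 x) =
            Fin.cons s x := by
          funext i
          refine Fin.cases ?_ (fun j => ?_) i
          · simp
          · simp only [Fin.cons_succ, Pi.add_apply, Pi.smul_apply, smul_eq_mul]
            ring
        rwa [e] at h
      rwa [bernoulliExp_add, bernoulliExp_const_mul, bernoulliExp_const_mul] at h
    rw [bernoulliExp_succ, bernoulliExp_succ p f]
    refine two_point_transport (hp 0) (fun s hs => (hstep 0 s).trans ?_)
      (fun s hs => (hstep 1 s).trans ?_)
    · rw [Real.exp_le_exp]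
      have := hF s hs
      nlinarith
    · rw [Real.exp_le_exp]
      have := hF s hs
      nlinarith

/-- A linear form is centered, and Young's inequality lets the transport inequality apply with `f`
the form plus half the squared norm of `c`. -/
theorem bernoulliExp_exp_linear_le {n : ℕ} {p : Fin n → ℝ} (hp : ∀ i, p i ∈ Set.Icc (0 : ℝ) 1)
    (c : Fin n → ℝ) :
    bernoulliExp p (fun x => Real.exp (∑ i, (x i - p i) * c i)) ≤
      Real.exp ((∑ i, c i ^ 2) / 2) := by
  have h := bernoulliExp_exp_le hp (f := fun x => ∑ i, (x i - p i) * c i + (∑ i, c i ^ 2) / 2)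
    (g := fun x => ∑ i, (x i - p i) * c i) ?_ ?_
  · rwa [bernoulliExp_add, bernoulliExp_const, bernoulliExp_centered_linear, zero_add] at h
  · refine ConvexOn.add ⟨convex_univ, fun x _ y _ a b ha hb hab => le_of_eq ?_⟩
      (convexOn_const _ convex_univ)
    simp only [smul_eq_mul, Finset.mul_sum, ← Finset.sum_add_distrib, Pi.add_apply, Pi.smul_apply]
    refine Finset.sum_congr rfl fun i _ => ?_
    linear_combination (p i * c i) * hab
  · intro x x'
    rw [add_assoc, ← add_div, ← Finset.sum_add_distrib, Finset.sum_div, ← Finset.sum_add_distrib]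
    refine Finset.sum_le_sum fun i _ => ?_
    nlinarith [sq_nonneg (x i - x' i - c i)]

/-! ### Support functions and their concentration. -/

/-- The support function of `V`. -/
noncomputable def supportFun {n : ℕ} (V : Set (Fin n → ℝ)) (x : Fin n → ℝ) : ℝ :=
  sSup ((fun h => ∑ i, x i * h i) '' V)

section SupportFun

variable {n : ℕ} {V : Set (Fin n → ℝ)} {t : ℝ}

theorem sum_mul_le_of_sum_sq_le (ht : 0 ≤ t) (x : Fin n → ℝ) {h : Fin n → ℝ}
    (hh : ∑ i, h i ^ 2 ≤ t ^ 2) : ∑ i, x i * h i ≤ √(∑ i, x i ^ 2) * t := by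
  refine (Real.sum_mul_le_sqrt_mul_sqrt _ _ _).trans ?_
  refine mul_le_mul_of_nonneg_left ?_ (Real.sqrt_nonneg _)
  exact Real.sqrt_le_iff.2 ⟨ht, hh⟩

theorem le_supportFun (ht : 0 ≤ t) (hV : ∀ h ∈ V, ∑ i, h i ^ 2 ≤ t ^ 2) (x : Fin n → ℝ)
    {h : Fin n → ℝ} (hh : h ∈ V) : ∑ i, x i * h i ≤ supportFun V x := by
  refine le_csSup ⟨√(∑ i, x i ^ 2) * t, ?_⟩ ⟨h, hh, rfl⟩
  rintro _ ⟨h, hh, rfl⟩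
  exact sum_mul_le_of_sum_sq_le ht x (hV h hh)

theorem supportFun_le (hne : V.Nonempty) {x : Fin n → ℝ} {a : ℝ}
    (h : ∀ h ∈ V, ∑ i, x i * h i ≤ a) : supportFun V x ≤ a := by
  refine csSup_le (hne.image _) ?_
  rintro _ ⟨v, hv, rfl⟩
  exact h v hv

/-- Concentration of the support function of a subset of the ball of radius `t`. -/
theorem bernoulliExp_exp_supportFun_le {p : Fin n → ℝ} (hp : ∀ i, p i ∈ Set.Icc (0 : ℝ) 1)
    (hne : V.Nonempty) (ht : 0 ≤ t) (hV : ∀ h ∈ V, ∑ i, h i ^ 2 ≤ t ^ 2) {l : ℝ} (hl : 0 ≤ l) :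
    bernoulliExp p (fun x => Real.exp (l * supportFun V (x - p))) ≤
      Real.exp (l * bernoulliExp p (fun x => supportFun V (x - p)) + l ^ 2 * t ^ 2 / 2) := by
  have h := bernoulliExp_exp_le hp
    (f := fun x => l * supportFun V (x - p) + l ^ 2 * t ^ 2 / 2)
    (g := fun x => l * supportFun V (x - p)) ?_ ?_
  · rwa [bernoulliExp_add, bernoulliExp_const, bernoulliExp_const_mul] at h
  · refine ConvexOn.add ?_ (convexOn_const _ convex_univ)
    refine ConvexOn.smul (c := l) hl ⟨convex_univ, fun x _ y _ a b ha hb hab => ?_⟩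
    refine supportFun_le hne fun h hh => ?_
    have h1 := mul_le_mul_of_nonneg_left (le_supportFun ht hV (x - p) hh) ha
    have h2 := mul_le_mul_of_nonneg_left (le_supportFun ht hV (y - p) hh) hb
    refine le_trans (le_of_eq ?_) (add_le_add h1 h2)
    simp only [Finset.mul_sum, ← Finset.sum_add_distrib, Pi.add_apply, Pi.sub_apply, Pi.smul_apply,
      smul_eq_mul]
    refine Finset.sum_congr rfl fun i _ => ?_
    linear_combination (p i * h i) * hab
  · intro x x'
    have h1 : supportFun V (x - p) ≤ supportFun V (x' - p) + √(∑ i, (x i - x' i) ^ 2) * t := by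
      refine supportFun_le hne fun h hh => ?_
      have h1 := le_supportFun ht hV (x' - p) hh
      have h2 := sum_mul_le_of_sum_sq_le ht (x - x') (hV h hh)
      refine le_trans (le_of_eq ?_) (add_le_add h1 h2)
      simp only [← Finset.sum_add_distrib, Pi.sub_apply]
      exact Finset.sum_congr rfl fun i _ => by ring
    have h2 := mul_le_mul_of_nonneg_left h1 hl
    have h3 := Real.sq_sqrt (Finset.sum_nonneg fun i (_ : i ∈ Finset.univ) =>
      sq_nonneg (x i - x' i))
    -- Young's inequality turns the Lipschitz term `l t r` into `r²/2 + l²t²/2`.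
    nlinarith [sq_nonneg (√(∑ i, (x i - x' i) ^ 2) - l * t)]

open Classical in
theorem bernoulliExp_supportFun_tail {p : Fin n → ℝ} (hp : ∀ i, p i ∈ Set.Icc (0 : ℝ) 1)
    (hne : V.Nonempty) (ht : 0 < t) (hV : ∀ h ∈ V, ∑ i, h i ^ 2 ≤ t ^ 2) {a x : ℝ} (hx : 0 ≤ x)
    (ha : bernoulliExp p (fun z => supportFun V (z - p)) ≤ a) :
    bernoulliExp p (fun z => if a + t * √(2 * x) < supportFun V (z - p) then 1 else 0) ≤
      Real.exp (-x) := by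
  -- The optimal Chernoff parameter: `-l t √(2x) + l²t²/2 = -x`.
  set l := √(2 * x) / t
  have hl : 0 ≤ l := by positivity
  have hlt : l * t = √(2 * x) := div_mul_cancel₀ _ ht.ne'
  have hs : √(2 * x) ^ 2 = 2 * x := Real.sq_sqrt (by linarith)
  have h1 := bernoulliExp_exp_supportFun_le hp hne ht.le hV hl
  have h2 : bernoulliExp p (fun z => if a + t * √(2 * x) < supportFun V (z - p) then 1 else 0) ≤
      bernoulliExp p (fun z => Real.exp (-(l * (a + t * √(2 * x)))) *
        Real.exp (l * supportFun V (z - p))) := by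
    refine bernoulliExp_mono hp fun z => ?_
    rw [← Real.exp_add]
    split_ifs with h
    · rw [Real.one_le_exp_iff]
      have := mul_le_mul_of_nonneg_left h.le hl
      linarith
    · positivity
  rw [bernoulliExp_const_mul] at h2
  refine h2.trans ((mul_le_mul_of_nonneg_left h1 (Real.exp_pos _).le).trans ?_)
  rw [← Real.exp_add, Real.exp_le_exp]
  have h3 := mul_le_mul_of_nonneg_left ha hl
  have h4 : l ^ 2 * t ^ 2 = 2 * x := by rw [← mul_pow, hlt, hs]
  have h5 : l * (t * √(2 * x)) = 2 * x := by rw [← mul_assoc, hlt, ← sq, hs]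
  linarith

end SupportFun

/-! ### Haar decomposition and coefficients of monotone sequences. -/

/-- The sums of a sequence over consecutive pairs. -/
def pairSum (a : ℕ → ℝ) (k : ℕ) : ℝ := a (2 * k) + a (2 * k + 1)

/-- The differences of a sequence over consecutive pairs. -/
def pairDiff (a : ℕ → ℝ) (k : ℕ) : ℝ := a (2 * k) - a (2 * k + 1)

/-- The extension by zero of a vector to a sequence. -/
def extendZero {n : ℕ} (a : Fin n → ℝ) (k : ℕ) : ℝ := ∑ i : Fin n, if (i : ℕ) = k then a i else 0

theorem sum_range_two_mul (f : ℕ → ℝ) (m : ℕ) :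
    ∑ i ∈ Finset.range (2 * m), f i = ∑ k ∈ Finset.range m, (f (2 * k) + f (2 * k + 1)) := by
  induction m with
  | zero => simp
  | succ m ih =>
    rw [mul_add, mul_one, Finset.sum_range_succ, Finset.sum_range_succ, ih,
      Finset.sum_range_succ _ m, add_assoc]

theorem sum_mul_eq_pairSum_add_pairDiff (a b : ℕ → ℝ) (m : ℕ) :
    ∑ i ∈ Finset.range (2 * m), a i * b i =
      (∑ k ∈ Finset.range m, pairSum a k * pairSum b k) / 2 +
        (∑ k ∈ Finset.range m, pairDiff a k * pairDiff b k) / 2 := by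
  rw [sum_range_two_mul, ← add_div, ← Finset.sum_add_distrib, Finset.sum_div]
  refine Finset.sum_congr rfl fun k _ => ?_
  simp only [pairSum, pairDiff]
  ring

/-- One step of the Haar decomposition of an inner product. -/
theorem haar_step (a b : ℕ → ℝ) (M : ℕ) {j E : ℕ} (hj : j < E) :
    (∑ k ∈ Finset.range (M * 2 ^ (E - j)), pairSum^[j] a k * pairSum^[j] b k) / 2 ^ j =
      (∑ k ∈ Finset.range (M * 2 ^ (E - (j + 1))), pairSum^[j + 1] a k * pairSum^[j + 1] b k) /
        2 ^ (j + 1) +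
      (∑ k ∈ Finset.range (M * 2 ^ (E - (j + 1))),
        pairDiff (pairSum^[j] a) k * pairDiff (pairSum^[j] b) k) / 2 ^ (j + 1) := by
  have h : M * 2 ^ (E - j) = 2 * (M * 2 ^ (E - (j + 1))) := by
    rw [show E - j = E - (j + 1) + 1 by omega, pow_succ]
    ring
  rw [h, sum_mul_eq_pairSum_add_pairDiff, Function.iterate_succ_apply',
    Function.iterate_succ_apply', pow_succ]
  field_simp

/-- The Haar decomposition of an inner product down to blocks of length `2 ^ E`. -/
theorem haar_decomposition (a b : ℕ → ℝ) (M E : ℕ) :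
    ∑ k ∈ Finset.range (M * 2 ^ E), a k * b k =
      ∑ j ∈ Finset.range E, (∑ k ∈ Finset.range (M * 2 ^ (E - (j + 1))),
        pairDiff (pairSum^[j] a) k * pairDiff (pairSum^[j] b) k) / 2 ^ (j + 1) +
      (∑ k ∈ Finset.range M, pairSum^[E] a k * pairSum^[E] b k) / 2 ^ E := by
  have h : ∀ l ≤ E, ∑ k ∈ Finset.range (M * 2 ^ E), a k * b k =
      ∑ j ∈ Finset.range l, (∑ k ∈ Finset.range (M * 2 ^ (E - (j + 1))),
        pairDiff (pairSum^[j] a) k * pairDiff (pairSum^[j] b) k) / 2 ^ (j + 1) +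
      (∑ k ∈ Finset.range (M * 2 ^ (E - l)), pairSum^[l] a k * pairSum^[l] b k) / 2 ^ l := by
    intro l
    induction l with
    | zero => simp
    | succ l ih =>
      intro hl
      rw [ih (by omega), haar_step a b M (by omega : l < E), Finset.sum_range_succ]
      ring
  simpa using h E le_rfl

theorem haar_sq_nonneg (b : ℕ → ℝ) (s : Finset ℕ) (j : ℕ) :
    0 ≤ (∑ k ∈ s, b k * b k) / 2 ^ j :=
  div_nonneg (Finset.sum_nonneg fun k _ => mul_self_nonneg _) (by positivity)

/-- Parseval: the energy splits into nonnegative contributions of the levels, so each is at most the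
total. -/
theorem haar_detail_sq_le (b : ℕ → ℝ) (M : ℕ) {j E : ℕ} (hj : j < E) :
    (∑ k ∈ Finset.range (M * 2 ^ (E - (j + 1))),
        pairDiff (pairSum^[j] b) k * pairDiff (pairSum^[j] b) k) / 2 ^ (j + 1) ≤
      ∑ k ∈ Finset.range (M * 2 ^ E), b k * b k := by
  rw [haar_decomposition b b M E]
  have h := Finset.single_le_sum (f := fun j => (∑ k ∈ Finset.range (M * 2 ^ (E - (j + 1))),
    pairDiff (pairSum^[j] b) k * pairDiff (pairSum^[j] b) k) / 2 ^ (j + 1))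
    (fun j _ => haar_sq_nonneg _ _ _) (Finset.mem_range.2 hj)
  exact h.trans (le_add_of_nonneg_right (haar_sq_nonneg _ _ _))

theorem haar_coarse_sq_le (b : ℕ → ℝ) (M E : ℕ) :
    (∑ k ∈ Finset.range M, pairSum^[E] b k * pairSum^[E] b k) / 2 ^ E ≤
      ∑ k ∈ Finset.range (M * 2 ^ E), b k * b k := by
  rw [haar_decomposition b b M E]
  exact le_add_of_nonneg_left (Finset.sum_nonneg fun j _ => haar_sq_nonneg _ _ _)

theorem iterate_pairSum_sub (v u : ℕ → ℝ) (j : ℕ) :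
    pairSum^[j] (fun i => v i - u i) = fun k => pairSum^[j] v k - pairSum^[j] u k := by
  induction j with
  | zero => rfl
  | succ j ih =>
    rw [Function.iterate_succ_apply', ih]
    funext k
    simp only [Function.iterate_succ_apply', pairSum]
    ring

theorem iterate_pairSum_monotone {v : ℕ → ℝ} (hv : Monotone v) (j : ℕ) :
    Monotone (pairSum^[j] v) := by
  induction j with
  | zero => exact hv
  | succ j ih =>
    rw [Function.iterate_succ_apply']
    exact fun k l hkl => add_le_add (ih (by omega)) (ih (by omega))

theorem iterate_pairSum_mem {v : ℕ → ℝ} (hv : ∀ i, v i ∈ Set.Icc (0 : ℝ) 1) (j k : ℕ) :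
    pairSum^[j] v k ∈ Set.Icc (0 : ℝ) (2 ^ j) := by
  induction j generalizing k with
  | zero => simpa using hv k
  | succ j ih =>
    have h1 := ih (2 * k)
    have h2 := ih (2 * k + 1)
    rw [Function.iterate_succ_apply', pairSum, pow_succ]
    exact ⟨by linarith [h1.1, h2.1], by linarith [h1.2, h2.2]⟩

/-- The increments are taken over disjoint intervals, so they add up to at most the total rise of
`w`. -/
theorem sum_abs_pairDiff_le_of_monotone {w : ℕ → ℝ} {c : ℝ} (hw : Monotone w)
    (hc : ∀ k, w k ∈ Set.Icc 0 c) (m : ℕ) :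
    ∑ k ∈ Finset.range m, |pairDiff w k| ≤ c := by
  have h : ∑ k ∈ Finset.range m, |pairDiff w k| ≤ w (2 * m) - w 0 := by
    induction m with
    | zero => simp
    | succ m ih =>
      have h1 : w (2 * m) ≤ w (2 * m + 1) := hw (by omega)
      have h2 : w (2 * m + 1) ≤ w (2 * (m + 1)) := hw (by omega)
      rw [Finset.sum_range_succ, pairDiff, abs_of_nonpos (by linarith)]
      linarith
  linarith [(hc 0).1, (hc (2 * m)).2]

/-- Block sums of `v` and of `u` are monotone with values in `[0, 2^j]`, and each contributes `2^j`.
After normalization by `√(2^(j+1))` this is the `ℓ¹` bound `√(2^(j+1))` on the detail coefficients.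
-/
theorem sum_abs_pairDiff_iterate_le {v u : ℕ → ℝ} (hv : Monotone v) (hu : Monotone u)
    (hv' : ∀ i, v i ∈ Set.Icc (0 : ℝ) 1) (hu' : ∀ i, u i ∈ Set.Icc (0 : ℝ) 1) (j m : ℕ) :
    ∑ k ∈ Finset.range m, |pairDiff (pairSum^[j] fun i => v i - u i) k| ≤ 2 ^ (j + 1) := by
  have h1 := sum_abs_pairDiff_le_of_monotone (iterate_pairSum_monotone hv j)
    (iterate_pairSum_mem hv' j) m
  have h2 := sum_abs_pairDiff_le_of_monotone (iterate_pairSum_monotone hu j)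
    (iterate_pairSum_mem hu' j) m
  rw [pow_succ, mul_two]
  refine le_trans ?_ (add_le_add h1 h2)
  rw [← Finset.sum_add_distrib, iterate_pairSum_sub]
  refine Finset.sum_le_sum fun k _ => ?_
  refine le_trans (le_of_eq (congrArg _ ?_)) (abs_sub _ _)
  simp only [pairDiff]
  ring

theorem iterate_pairSum_extendZero {n : ℕ} (a : Fin n → ℝ) (j k : ℕ) :
    pairSum^[j] (extendZero a) k = ∑ i : Fin n, if (i : ℕ) / 2 ^ j = k then a i else 0 := by
  induction j generalizing k with
  | zero => simp [extendZero]
  | succ j ih =>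
    rw [Function.iterate_succ_apply', pairSum, ih, ih, ← Finset.sum_add_distrib]
    refine Finset.sum_congr rfl fun i _ => ?_
    rw [pow_succ, ← Nat.div_div_eq_div_mul]
    generalize (i : ℕ) / 2 ^ j = q
    split_ifs <;> first | omega | simp

theorem extendZero_one_mem {n : ℕ} (k : ℕ) :
    extendZero (fun _ : Fin n => (1 : ℝ)) k ∈ Set.Icc (0 : ℝ) 1 := by
  unfold extendZero
  refine ⟨Finset.sum_nonneg fun i _ => by split_ifs <;> norm_num, ?_⟩
  rw [Finset.sum_boole]
  norm_cast
  rw [Finset.card_le_one]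
  intro i hi j hj
  simp only [Finset.mem_filter, Finset.mem_univ, true_and] at hi hj
  exact Fin.ext (hi.trans hj.symm)

theorem sum_extendZero_mul {n N : ℕ} (hN : n ≤ N) (a : Fin n → ℝ) (f : ℕ → ℝ) :
    ∑ k ∈ Finset.range N, extendZero a k * f k = ∑ i : Fin n, a i * f i := by
  simp only [extendZero, Finset.sum_mul]
  rw [Finset.sum_comm]
  refine Finset.sum_congr rfl fun i _ => ?_
  rw [Finset.sum_eq_single (i : ℕ)]
  · simp
  · intro k _ hk
    simp [hk.symm]
  · intro h
    exact absurd (Finset.mem_range.2 (i.2.trans_le hN)) h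

/-- The iterated block sums of the extension of a vector are linear functionals of squared norm
at most the length of the block. -/
theorem exists_iterate_pairSum_eq (n j k : ℕ) : ∃ c : Fin n → ℝ, ∑ i, c i ^ 2 ≤ 2 ^ j ∧
    ∀ a : Fin n → ℝ, pairSum^[j] (extendZero a) k = ∑ i, a i * c i := by
  refine ⟨fun i => if (i : ℕ) / 2 ^ j = k then 1 else 0, ?_, fun a => ?_⟩
  -- The weights are `0` or `1`, so their squared norm is the block sum of the constant vector `1`.
  · refine le_trans (le_of_eq ?_) (iterate_pairSum_mem (extendZero_one_mem (n := n)) j k).2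
    rw [iterate_pairSum_extendZero]
    exact Finset.sum_congr rfl fun i _ => by beta_reduce; split_ifs <;> simp
  · rw [iterate_pairSum_extendZero]
    exact Finset.sum_congr rfl fun i _ => by beta_reduce; split_ifs <;> simp

theorem exists_pairDiff_iterate_eq (n j k : ℕ) : ∃ c : Fin n → ℝ, ∑ i, c i ^ 2 ≤ 2 ^ (j + 1) ∧
    ∀ a : Fin n → ℝ, pairDiff (pairSum^[j] (extendZero a)) k = ∑ i, a i * c i := by
  refine ⟨fun i => (if (i : ℕ) / 2 ^ j = 2 * k then 1 else 0) -
    (if (i : ℕ) / 2 ^ j = 2 * k + 1 then 1 else 0), ?_, fun a => ?_⟩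
  · refine le_trans (le_of_eq ?_) (iterate_pairSum_mem (extendZero_one_mem (n := n)) (j + 1) k).2
    rw [Function.iterate_succ_apply', pairSum, iterate_pairSum_extendZero,
      iterate_pairSum_extendZero, ← Finset.sum_add_distrib]
    exact Finset.sum_congr rfl fun i _ => by
      beta_reduce; split_ifs <;> first | omega | simp
  · rw [pairDiff, iterate_pairSum_extendZero, iterate_pairSum_extendZero,
      ← Finset.sum_sub_distrib]
    exact Finset.sum_congr rfl fun i _ => by beta_reduce; split_ifs <;> simp

/-! ### Thresholded noise and the expected width. -/

/-- Uses `w²/2 ≤ e^w` at `w = |z| - τ ≥ 0` and `e^|z| ≤ e^z + e^{-z}`. -/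
theorem sq_max_abs_sub_le (z τ : ℝ) :
    max (|z| - τ) 0 ^ 2 ≤ 2 * Real.exp (-τ) * (Real.exp z + Real.exp (-z)) := by
  rcases le_total (|z| - τ) 0 with h | h
  · rw [max_eq_right h, zero_pow two_ne_zero]
    positivity
  · rw [max_eq_left h]
    have h1 := Real.quadratic_le_exp_of_nonneg h
    have h2 : Real.exp |z| ≤ Real.exp z + Real.exp (-z) := by
      rcases abs_choice z with h | h <;> rw [h] <;> linarith [Real.exp_pos z, Real.exp_pos (-z)]
    have h3 := mul_le_mul_of_nonneg_left h2 (Real.exp_pos (-τ)).le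
    rw [← Real.exp_add, neg_add_eq_sub] at h3
    linarith

theorem bernoulliExp_sq_max_le {n : ℕ} {p : Fin n → ℝ} (hp : ∀ i, p i ∈ Set.Icc (0 : ℝ) 1)
    {c : Fin n → ℝ} {s : ℝ} (hs : 0 < s) (hc : ∑ i, c i ^ 2 ≤ s ^ 2) (τ : ℝ) :
    bernoulliExp p (fun x => max (|(∑ i, (x i - p i) * c i) / s| - τ) 0 ^ 2) ≤
      8 * Real.exp (-τ) := by
  have h2 : Real.exp (1 / 2) ≤ 2 := by
    obtain ⟨h1, h2⟩ := abs_le_of_sq_le_sq' (a := Real.exp (1 / 2)) (b := 2) (by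
      rw [← Real.exp_nat_mul]
      norm_num
      linarith [Real.exp_one_lt_d9]) (by norm_num)
    exact h2
  have key : ∀ ε : ℝ, ε ^ 2 = 1 →
      bernoulliExp p (fun x => Real.exp (ε * ((∑ i, (x i - p i) * c i) / s))) ≤ 2 := by
    intro ε hε
    have h := bernoulliExp_exp_linear_le hp (fun i => ε * (c i / s))
    have e : ∀ x : Fin n → ℝ, ∑ i, (x i - p i) * (ε * (c i / s)) =
        ε * ((∑ i, (x i - p i) * c i) / s) := by
      intro x
      rw [Finset.sum_div, Finset.mul_sum]
      exact Finset.sum_congr rfl fun i _ => by ring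
    simp only [e] at h
    refine h.trans (le_trans (Real.exp_le_exp.2 ?_) h2)
    simp only [mul_pow, hε, one_mul, div_pow, ← Finset.sum_div]
    have := (div_le_one (by positivity : 0 < s ^ 2)).2 hc
    linarith
  refine (bernoulliExp_mono hp fun x => sq_max_abs_sub_le _ τ).trans ?_
  rw [bernoulliExp_const_mul, bernoulliExp_add]
  have h3 := key 1 (by norm_num)
  have h4 := key (-1) (by norm_num)
  simp only [one_mul, neg_mul] at h3 h4
  nlinarith [Real.exp_pos (-τ)]

/-- Split `|z| ≤ τ + (|z| - τ)₊`: the bounded part meets the `ℓ¹` norm of `θ`, the excess meets its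
`ℓ²` norm by Cauchy–Schwarz. -/
theorem sum_mul_le_truncated {ι : Type*} (s : Finset ι) (θ z : ι → ℝ) {τ L t : ℝ} (hτ : 0 ≤ τ)
    (ht : 0 ≤ t) (h1 : ∑ k ∈ s, |θ k| ≤ L) (h2 : ∑ k ∈ s, θ k ^ 2 ≤ t ^ 2) :
    ∑ k ∈ s, z k * θ k ≤ L * τ + t * √(∑ k ∈ s, max (|z k| - τ) 0 ^ 2) := by
  have h3 : ∑ k ∈ s, z k * θ k ≤ ∑ k ∈ s, (|θ k| * τ + |θ k| * max (|z k| - τ) 0) := by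
    refine Finset.sum_le_sum fun k _ => ?_
    rw [← mul_add]
    refine (le_abs_self _).trans ?_
    rw [abs_mul, mul_comm]
    refine mul_le_mul_of_nonneg_left ?_ (abs_nonneg _)
    linarith [le_max_left (|z k| - τ) 0]
  refine h3.trans ?_
  rw [Finset.sum_add_distrib, ← Finset.sum_mul]
  refine add_le_add (mul_le_mul_of_nonneg_right h1 hτ) ?_
  refine (Real.sum_mul_le_sqrt_mul_sqrt _ _ _).trans ?_
  refine mul_le_mul_of_nonneg_right ?_ (Real.sqrt_nonneg _)
  exact Real.sqrt_le_iff.2 ⟨ht, by simpa only [sq_abs] using h2⟩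

/-- The expected width of a set of differences of bounded monotone sequences. -/
theorem bernoulliExp_supportFun_le {n : ℕ} {p : Fin n → ℝ} (hp : ∀ i, p i ∈ Set.Icc (0 : ℝ) 1)
    {V : Set (Fin n → ℝ)} (hne : V.Nonempty) {t : ℝ} (ht : 0 ≤ t)
    (hV : ∀ h ∈ V, ∑ i, h i ^ 2 ≤ t ^ 2)
    (hmono : ∀ h ∈ V, ∃ v u : ℕ → ℝ, Monotone v ∧ Monotone u ∧ (∀ i, v i ∈ Set.Icc (0 : ℝ) 1) ∧
      (∀ i, u i ∈ Set.Icc (0 : ℝ) 1) ∧ (fun i => v i - u i) = extendZero h)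
    {M E : ℕ} (hME : n ≤ M * 2 ^ E) {τ : ℕ → ℝ} (hτ : ∀ j, 0 ≤ τ j) :
    bernoulliExp p (fun x => supportFun V (x - p)) ≤
      ∑ j ∈ Finset.range E, (√(2 ^ (j + 1)) * τ j +
        t * √((M * 2 ^ (E - (j + 1)) : ℕ) * (8 * Real.exp (-τ j)))) + t * √(M * 8) := by
  let G : ℕ → (Fin n → ℝ) → ℝ := fun j x => ∑ k ∈ Finset.range (M * 2 ^ (E - (j + 1))),
    max (|pairDiff (pairSum^[j] (extendZero (x - p))) k / √(2 ^ (j + 1))| - τ j) 0 ^ 2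
  let H : (Fin n → ℝ) → ℝ := fun x => ∑ k ∈ Finset.range M,
    max (|pairSum^[E] (extendZero (x - p)) k / √(2 ^ E)| - 0) 0 ^ 2
  have hG0 : ∀ j x, 0 ≤ G j x := fun j x => Finset.sum_nonneg fun k _ => sq_nonneg _
  have hH0 : ∀ x, 0 ≤ H x := fun x => Finset.sum_nonneg fun k _ => sq_nonneg _
  have hsq : ∀ j : ℕ, √((2 : ℝ) ^ j) ^ 2 = 2 ^ j := fun j => Real.sq_sqrt (by positivity)
  have hspos : ∀ j : ℕ, 0 < √((2 : ℝ) ^ j) := fun j => Real.sqrt_pos.2 (by positivity)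
  have hG : ∀ j, bernoulliExp p (G j) ≤
      (M * 2 ^ (E - (j + 1)) : ℕ) * (8 * Real.exp (-τ j)) := by
    intro j
    simp only [G, bernoulliExp_sum]
    rw [← nsmul_eq_mul]
    refine (Finset.sum_le_card_nsmul _ _ _ fun k _ => ?_).trans_eq (by rw [Finset.card_range])
    obtain ⟨c, hc, hc'⟩ := exists_pairDiff_iterate_eq n j k
    simp only [hc']
    exact bernoulliExp_sq_max_le hp (hspos _) (by rwa [hsq]) (τ j)
  have hH : bernoulliExp p H ≤ M * 8 := by
    simp only [H, bernoulliExp_sum]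
    rw [← nsmul_eq_mul]
    refine (Finset.sum_le_card_nsmul _ _ _ fun k _ => ?_).trans_eq (by rw [Finset.card_range])
    obtain ⟨c, hc, hc'⟩ := exists_iterate_pairSum_eq n E k
    simp only [hc']
    exact (bernoulliExp_sq_max_le hp (hspos _) (by rwa [hsq]) 0).trans (by simp)
  have hdet : ∀ x, supportFun V (x - p) ≤
      ∑ j ∈ Finset.range E, (√(2 ^ (j + 1)) * τ j + t * √(G j x)) + t * √(H x) := by
    intro x
    refine supportFun_le hne fun h hh => ?_
    obtain ⟨v, u, hv, hu, hv', hu', hvu⟩ := hmono h hh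
    have e1 : ∑ i, (x - p) i * h i =
        ∑ k ∈ Finset.range (M * 2 ^ E), extendZero (x - p) k * extendZero h k := by
      rw [sum_extendZero_mul hME]
      refine Finset.sum_congr rfl fun i _ => ?_
      simp [extendZero, Fin.val_inj]
    have e2 : ∑ k ∈ Finset.range (M * 2 ^ E), extendZero h k * extendZero h k ≤ t ^ 2 := by
      rw [sum_extendZero_mul hME]
      refine le_trans (le_of_eq ?_) (hV h hh)
      refine Finset.sum_congr rfl fun i _ => ?_
      simp [extendZero, Fin.val_inj, sq]
    rw [e1, haar_decomposition]
    refine add_le_add (Finset.sum_le_sum fun j hj => ?_) ?_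
    · have hs := hsq (j + 1)
      have hs0 := hspos (j + 1)
      set s := √((2 : ℝ) ^ (j + 1))
      have h1 := sum_mul_le_truncated (Finset.range (M * 2 ^ (E - (j + 1))))
        (fun k => pairDiff (pairSum^[j] (extendZero h)) k / s)
        (fun k => pairDiff (pairSum^[j] (extendZero (x - p))) k / s) (L := s) (hτ j) ht ?_ ?_
      · refine le_trans (le_of_eq ?_) h1
        rw [← hs, Finset.sum_div]
        exact Finset.sum_congr rfl fun k _ => by rw [div_mul_div_comm, sq]
      · have h2 := sum_abs_pairDiff_iterate_le hv hu hv' hu' j (M * 2 ^ (E - (j + 1)))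
        rw [hvu, ← hs] at h2
        simp only [abs_div, abs_of_pos hs0, ← Finset.sum_div]
        rw [div_le_iff₀ hs0, ← sq]
        exact h2
      · have h2 := (haar_detail_sq_le (extendZero h) M (Finset.mem_range.1 hj)).trans e2
        simpa only [div_pow, hs, ← Finset.sum_div, ← sq] using h2
    · have hs := hsq E
      -- The threshold is `0` on the coarse level, so any `L` will do: Cauchy–Schwarz alone is used.
      have h1 := sum_mul_le_truncated (Finset.range M)
        (fun k => pairSum^[E] (extendZero h) k / √(2 ^ E))
        (fun k => pairSum^[E] (extendZero (x - p)) k / √(2 ^ E)) le_rfl ht le_rfl ?_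
      · rw [mul_zero, zero_add] at h1
        refine le_trans (le_of_eq ?_) h1
        rw [← hs, Finset.sum_div]
        refine Finset.sum_congr rfl fun k _ => ?_
        rw [hs, div_mul_div_comm, Real.mul_self_sqrt (by positivity)]
      · have h2 := (haar_coarse_sq_le (extendZero h) M E).trans e2
        simpa only [div_pow, hs, ← Finset.sum_div, ← sq] using h2
  refine (bernoulliExp_mono hp hdet).trans ?_
  simp only [bernoulliExp_add, bernoulliExp_sum, bernoulliExp_const, bernoulliExp_const_mul]
  refine add_le_add (Finset.sum_le_sum fun j _ => add_le_add le_rfl ?_) ?_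
  · exact mul_le_mul_of_nonneg_left
      ((bernoulliExp_sqrt_le hp (hG0 j)).trans (Real.sqrt_le_sqrt (hG j))) ht
  · exact mul_le_mul_of_nonneg_left
      ((bernoulliExp_sqrt_le hp hH0).trans (Real.sqrt_le_sqrt hH)) ht

/-! ### Choice of thresholds, block length and critical radius. -/

theorem sqrt_pow_eq {a : ℝ} (ha : 0 ≤ a) (m : ℕ) : √(a ^ m) = √a ^ m := by
  induction m with
  | zero => simp
  | succ m ih => rw [pow_succ, Real.sqrt_mul (pow_nonneg ha m), ih, pow_succ]

/-- With `m = E - (j + 1)` the distance to the coarsest detail level, the threshold `2m` makes both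
sums converge: `√(2^(j+1))` loses `2^{-m/2}` against the factor `m`, and `e^{-2m}` beats the `M 2^m`
coefficients. -/
theorem exists_width_constants : ∃ A B : ℝ, 0 ≤ A ∧ 0 ≤ B ∧ ∀ (M E : ℕ) (t : ℝ), 0 ≤ t →
    ∑ j ∈ Finset.range E, (√(2 ^ (j + 1)) * (2 * (E - (j + 1) : ℕ)) +
      t * √((M * 2 ^ (E - (j + 1)) : ℕ) * (8 * Real.exp (-(2 * (E - (j + 1) : ℕ)))))) +
        t * √(M * 8) ≤ A * √(2 ^ E) + B * t * √M := by
  set r : ℝ := √(1 / 2)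
  set q : ℝ := √(2 * Real.exp (-2))
  have hr0 : 0 ≤ r := Real.sqrt_nonneg _
  have hq0 : 0 ≤ q := Real.sqrt_nonneg _
  have hr1 : r < 1 := by
    rw [Real.sqrt_lt' one_pos]
    norm_num
  have hq1 : q < 1 := by
    rw [Real.sqrt_lt' one_pos, Real.exp_neg, ← div_eq_mul_inv, div_lt_iff₀ (Real.exp_pos _)]
    linarith [Real.add_one_le_exp 2]
  have hs1 : Summable fun m : ℕ => (m : ℝ) * r ^ m := by
    simpa using summable_pow_mul_geometric_of_norm_lt_one 1 (r := r)
      (by rwa [Real.norm_of_nonneg hr0])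
  have hs2 : Summable fun m : ℕ => q ^ m := summable_geometric_of_lt_one hq0 hq1
  have hA0 : 0 ≤ ∑' m : ℕ, (m : ℝ) * r ^ m := tsum_nonneg fun m => by positivity
  have hB0 : 0 ≤ ∑' m : ℕ, q ^ m := tsum_nonneg fun m => by positivity
  -- The `+ 1` in the second constant pays for the coarse term.
  refine ⟨2 * ∑' m : ℕ, (m : ℝ) * r ^ m, √8 * (∑' m : ℕ, q ^ m + 1), by positivity, by positivity,
    fun M E t ht => ?_⟩
  have hterm : ∀ j ∈ Finset.range E, √(2 ^ (j + 1)) * (2 * (E - (j + 1) : ℕ)) +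
      t * √((M * 2 ^ (E - (j + 1)) : ℕ) * (8 * Real.exp (-(2 * (E - (j + 1) : ℕ))))) =
      2 * √(2 ^ E) * ((E - 1 - j : ℕ) * r ^ (E - 1 - j)) +
        √8 * t * √M * q ^ (E - 1 - j) := by
    intro j hj
    have hj := Finset.mem_range.1 hj
    have e1 : E - 1 - j = E - (j + 1) := by omega
    obtain ⟨m, rfl⟩ : ∃ m, E = j + 1 + m := ⟨E - (j + 1), by omega⟩
    rw [e1, Nat.add_sub_cancel_left]
    have e2 : √((2 : ℝ) ^ (j + 1)) = √(2 ^ (j + 1 + m)) * r ^ m := by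
      rw [← sqrt_pow_eq (by norm_num), ← Real.sqrt_mul (by positivity),
        pow_add 2 (j + 1) m, mul_assoc, ← mul_pow]
      norm_num
    have e3 : √((M * 2 ^ m : ℕ) * (8 * Real.exp (-(2 * m)))) = √8 * √M * q ^ m := by
      rw [← sqrt_pow_eq (by positivity), ← Real.sqrt_mul (by norm_num),
        ← Real.sqrt_mul (by positivity), mul_pow, ← Real.exp_nat_mul]
      congr 1
      push_cast
      rw [show -(2 * (m : ℝ)) = m * -2 by ring]
      ring
    rw [e2, e3]
    ring
  rw [Finset.sum_congr rfl hterm, Finset.sum_range_reflect (fun m => 2 * √(2 ^ E) *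
    ((m : ℕ) * r ^ m) + √8 * t * √M * q ^ m) E, Finset.sum_add_distrib, ← Finset.mul_sum,
    ← Finset.mul_sum, mul_comm (M : ℝ) 8, Real.sqrt_mul (by norm_num)]
  have h1 := mul_le_mul_of_nonneg_left (hs1.sum_le_tsum (Finset.range E) fun m _ => by positivity)
    (by positivity : 0 ≤ 2 * √((2 : ℝ) ^ E))
  have h2 := mul_le_mul_of_nonneg_left (hs2.sum_le_tsum (Finset.range E) fun m _ => by positivity)
    (by positivity : 0 ≤ √8 * t * √(M : ℝ))
  linarith

/-- Taking `2^E ≤ ν⁴ < 2^(E+1)` gives blocks of length about `n^(2/3)` and about `n^(1/3)` of them.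
This makes `√(2^E)` and `t√M` both of order `ν²` when `t` is of order `ν`. -/
theorem exists_block_partition {n : ℕ} {ν : ℝ} (hν : 1 ≤ ν) (hn : ν ^ 6 = n) :
    ∃ M E : ℕ, n ≤ M * 2 ^ E ∧ √(2 ^ E) ≤ ν ^ 2 ∧ √M ≤ 2 * ν := by
  obtain ⟨E, h1, h2⟩ := exists_nat_pow_near (one_le_pow₀ hν : 1 ≤ ν ^ 4) (one_lt_two)
  have hν0 : 0 < ν := by linarith
  refine ⟨n / 2 ^ E + 1, E, ?_, ?_, ?_⟩
  · rw [add_mul, one_mul]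
    exact (Nat.lt_div_mul_add (Nat.two_pow_pos E)).le
  · exact Real.sqrt_le_iff.2 ⟨by positivity, h1.trans_eq (by ring)⟩
  · refine Real.sqrt_le_iff.2 ⟨by positivity, ?_⟩
    have h3 : ((n / 2 ^ E : ℕ) : ℝ) ≤ (n : ℝ) / 2 ^ E := by
      have := Nat.cast_div_le (α := ℝ) (m := n) (n := 2 ^ E)
      push_cast at this
      exact this
    have h4 : (n : ℝ) / 2 ^ E ≤ 2 * ν ^ 2 := by
      rw [div_le_iff₀ (by positivity), ← hn]
      have h5 := mul_le_mul_of_nonneg_left h2.le (sq_nonneg ν)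
      rw [pow_succ 2 E] at h5
      linarith
    push_cast
    nlinarith

/-- The elements of `M_n(0, 1)` within distance `t` of `u`, centered at `u`. -/
def localizedBox {n : ℕ} (u : EuclideanSpace ℝ (Fin n)) (t : ℝ) : Set (Fin n → ℝ) :=
  {h | ∃ w ∈ isotonicBox n 0 1, ‖w - u‖ ≤ t ∧ h = fun i => w i - u i}

theorem localizedBox_sq_le {n : ℕ} {u : EuclideanSpace ℝ (Fin n)} {t : ℝ} :
    ∀ h ∈ localizedBox u t, ∑ i, h i ^ 2 ≤ t ^ 2 := by
  rintro _ ⟨w, -, hw, rfl⟩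
  have h := pow_le_pow_left₀ (norm_nonneg _) hw 2
  rwa [EuclideanSpace.real_norm_sq_eq] at h

theorem localizedBox_nonempty {n : ℕ} {u : EuclideanSpace ℝ (Fin n)} (hu : u ∈ isotonicBox n 0 1)
    {t : ℝ} (ht : 0 ≤ t) : (localizedBox u t).Nonempty :=
  ⟨_, u, hu, by simpa using ht, rfl⟩

/-- The extension by one of a vector to a sequence. -/
def extendOne {n : ℕ} (a : Fin n → ℝ) (k : ℕ) : ℝ := if h : k < n then a ⟨k, h⟩ else 1

theorem extendOne_mem {n : ℕ} {v : EuclideanSpace ℝ (Fin n)} (hv : v ∈ isotonicBox n 0 1) (k : ℕ) :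
    extendOne (fun i => v i) k ∈ Set.Icc (0 : ℝ) 1 := by
  unfold extendOne
  split_ifs with h
  · exact hv.2 _
  · simp

theorem extendOne_monotone {n : ℕ} {v : EuclideanSpace ℝ (Fin n)} (hv : v ∈ isotonicBox n 0 1) :
    Monotone (extendOne fun i => v i) := by
  intro k l hkl
  by_cases hl : l < n
  · simp only [extendOne, hl, hkl.trans_lt hl, dite_true]
    exact hv.1 (Fin.mk_le_mk.2 hkl)
  · exact (extendOne_mem hv k).2.trans_eq (by simp [extendOne, hl])

/-- Padding by `1` preserves monotonicity and the range `[0, 1]`, and the padding cancels in the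
difference. -/
theorem extendOne_sub_extendOne {n : ℕ} (a b : Fin n → ℝ) :
    (fun k => extendOne a k - extendOne b k) = extendZero fun i => a i - b i := by
  funext k
  by_cases hk : k < n
  · simp only [extendOne, extendZero, hk, dite_true]
    rw [Finset.sum_eq_single (⟨k, hk⟩ : Fin n)]
    · simp
    · intro i _ hi
      exact if_neg fun h => hi (Fin.ext h)
    · simp
  · simp only [extendOne, extendZero, hk, dite_false, sub_self]
    refine (Finset.sum_eq_zero fun i _ => if_neg fun h => hk ?_).symm
    exact h ▸ i.2

/-- The expected localized width at radius `c n^{1/6}` is at most half the squared radius. -/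
theorem exists_critical_radius : ∃ c : ℝ, 0 < c ∧ ∀ (n : ℕ) (ν : ℝ), 1 ≤ ν → ν ^ 6 = n →
    ∀ p : Fin n → ℝ, (∀ i, p i ∈ Set.Icc (0 : ℝ) 1) → ∀ u ∈ isotonicBox n 0 1,
      bernoulliExp p (fun x => supportFun (localizedBox u (c * ν)) (x - p)) ≤ (c * ν) ^ 2 / 2 := by
  obtain ⟨A, B, hA, hB, hAB⟩ := exists_width_constants
  -- Chosen so that `A + 2Bc ≤ c(A + 2B + 1) = c²/2`.
  set c := 4 * B + 2 * A + 2 with hc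
  have hc0 : 0 < c := by positivity
  refine ⟨c, hc0, fun n ν hν hn p hp u hu => ?_⟩
  obtain ⟨M, E, hME, hE, hM⟩ := exists_block_partition hν hn
  have ht : 0 ≤ c * ν := by positivity
  have h1 := bernoulliExp_supportFun_le hp (localizedBox_nonempty hu ht) ht localizedBox_sq_le ?_
    hME (τ := fun j => 2 * (E - (j + 1) : ℕ)) (fun j => by positivity)
  · refine h1.trans ((hAB M E _ ht).trans ?_)
    have h2 := mul_le_mul_of_nonneg_left hE hA
    have h3 := mul_le_mul_of_nonneg_left hM (by positivity : 0 ≤ B * (c * ν))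
    have h4 : A + 2 * B * c ≤ c ^ 2 / 2 := by nlinarith [mul_nonneg hA hB]
    nlinarith [mul_le_mul_of_nonneg_right h4 (sq_nonneg ν)]
  · rintro _ ⟨w, hw, -, rfl⟩
    exact ⟨_, _, extendOne_monotone hw, extendOne_monotone hu, extendOne_mem hw, extendOne_mem hu,
      extendOne_sub_extendOne _ _⟩

/-! ### Deterministic analysis of the projection onto a convex set. -/

theorem IsLeastSquares.inner_le_zero {n : ℕ} {K : Set (EuclideanSpace ℝ (Fin n))}
    (hK : Convex ℝ K) {y v u : EuclideanSpace ℝ (Fin n)} (hv : IsLeastSquares K y v)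
    (hu : u ∈ K) : inner ℝ (y - v) (u - v) ≤ 0 := by
  refine (norm_eq_iInf_iff_real_inner_le_zero hK hv.1).1 ?_ u hu
  have : Nonempty K := ⟨⟨v, hv.1⟩⟩
  refine le_antisymm (le_ciInf fun w => ?_) (ciInf_le ⟨0, ?_⟩ (⟨v, hv.1⟩ : K))
  · exact le_of_sq_le_sq (hv.2 w.2) (norm_nonneg _)
  · rintro _ ⟨w, rfl⟩
    exact norm_nonneg _

/-- Expand `‖u - μ‖²` around `v` and insert the variational inequality of the projection. The
retained `-‖v - u‖²` is what allows constant `1` in front of the approximation error. -/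
theorem IsLeastSquares.norm_sub_sq_le {n : ℕ} {K : Set (EuclideanSpace ℝ (Fin n))}
    (hK : Convex ℝ K) {y v u : EuclideanSpace ℝ (Fin n)} (hv : IsLeastSquares K y v)
    (hu : u ∈ K) (μ : EuclideanSpace ℝ (Fin n)) :
    ‖v - μ‖ ^ 2 ≤ ‖u - μ‖ ^ 2 + (2 * inner ℝ (y - μ) (v - u) - ‖v - u‖ ^ 2) := by
  have h1 := hv.inner_le_zero hK hu
  have h2 : u - μ = (v - μ) - (v - u) := by abel
  have h3 : inner ℝ (y - v) (u - v) = inner ℝ (v - μ) (v - u) - inner ℝ (y - μ) (v - u) := by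
    rw [← inner_sub_left, ← inner_neg_neg]
    congr 1 <;> abel
  rw [h2, norm_sub_sq_real (v - μ)]
  linarith

/-- A bound for the linear functional on the elements of a convex set close to `u` extends to the
whole set. -/
theorem two_mul_inner_sub_sq_le {F : Type*} [NormedAddCommGroup F] [InnerProductSpace ℝ F]
    {K : Set F} (hK : Convex ℝ K) {ξ u v : F} (hu : u ∈ K) (hv : v ∈ K) {t s : ℝ}
    (ht : 0 < t) (hs : 0 ≤ s)
    (h : ∀ w ∈ K, ‖w - u‖ ≤ t → inner ℝ ξ (w - u) ≤ t ^ 2 / 2 + t * s) :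
    2 * inner ℝ ξ (v - u) - ‖v - u‖ ^ 2 ≤ (t + s) ^ 2 := by
  rcases le_total ‖v - u‖ t with hr | hr
  · nlinarith [h v hv hr, sq_nonneg ‖v - u‖, sq_nonneg s]
  · set r := ‖v - u‖
    have hr0 : 0 < r := ht.trans_le hr
    have ha : t / r ∈ Set.Icc (0 : ℝ) 1 := ⟨by positivity, (div_le_one hr0).2 hr⟩
    have e : u + (t / r) • (v - u) - u = (t / r) • (v - u) := by abel
    have h1 := h (u + (t / r) • (v - u)) (hK.add_smul_sub_mem hu hv ha) (by
      rw [e, norm_smul, Real.norm_of_nonneg ha.1]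
      exact (div_mul_cancel₀ t hr0.ne').le)
    rw [e, inner_smul_right, div_mul_eq_mul_div, div_le_iff₀ hr0] at h1
    -- Beyond distance `t`, the bound at the point of the segment at distance exactly `t` grows
    -- linearly in `r`, and `2(t/2 + s)r - r² ≤ (t/2 + s)²`.
    have h2 : inner ℝ ξ (v - u) ≤ (t / 2 + s) * r := by
      refine le_of_mul_le_mul_left (h1.trans_eq ?_) ht
      ring
    nlinarith [sq_nonneg (t / 2 + s - r)]

/-! ### Transfer from the probability space to the finite product. -/

section Law

variable {n : ℕ} {Ω : Type*} [MeasurableSpace Ω] {P : Measure Ω}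
  {μ : EuclideanSpace ℝ (Fin n)} {hμ : ∀ i, μ i ∈ unitInterval}
  {y : Ω → EuclideanSpace ℝ (Fin n)}

theorem measureReal_eq_bernoulliWeight
    (hy : ∀ i, HasLaw (fun ω => y ω i) (bernoulliMeasure (1 : ℝ) 0 ⟨μ i, hμ i⟩) P)
    (hind : iIndepFun (fun i ω => y ω i) P) (b : Fin n → Bool) :
    P.real {ω | ∀ i, y ω i = boolVec b i} = bernoulliWeight (fun i => μ i) b := by
  have h := hind.measure_inter_preimage_eq_mul Finset.univ (sets := fun i => {boolVec b i})
    fun i _ => measurableSet_singleton _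
  have e : {ω | ∀ i, y ω i = boolVec b i} =
      ⋂ i ∈ (Finset.univ : Finset (Fin n)), (fun ω => y ω i) ⁻¹' {boolVec b i} := by
    ext ω
    simp
  rw [e, measureReal_def, h, ENNReal.toReal_prod]
  refine Finset.prod_congr rfl fun i _ => ?_
  classical
  have h1 := (hy i).measureReal_eq (p := fun z => z ∈ ({boolVec b i} : Set ℝ))
    (measurableSet_singleton _)
  rw [Set.ofPred_mem_eq] at h1
  rw [bernoulliMeasure_real_apply _ (measurableSet_singleton (boolVec b i))] at h1
  refine h1.trans ?_
  cases hb : b i <;> simp [boolVec, hb]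

theorem measureReal_not_boolVec
    (hy : ∀ i, HasLaw (fun ω => y ω i) (bernoulliMeasure (1 : ℝ) 0 ⟨μ i, hμ i⟩) P) :
    P.real {ω | ¬ ∀ i, y ω i = 0 ∨ y ω i = 1} = 0 := by
  have e : {ω | ¬ ∀ i, y ω i = 0 ∨ y ω i = 1} = ⋃ i, {ω | ¬ (y ω i = 0 ∨ y ω i = 1)} := by
    ext ω
    simp
  refine le_antisymm ?_ measureReal_nonneg
  rw [e]
  refine (measureReal_iUnion_fintype_le _).trans (Finset.sum_nonpos fun i _ => ?_)
  classical
  have hm : MeasurableSet {z : ℝ | ¬ (z = 0 ∨ z = 1)} :=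
    ((measurableSet_singleton 0).union (measurableSet_singleton 1)).compl
  have h1 := (hy i).measureReal_eq hm
  rw [bernoulliMeasure_real_apply _ hm] at h1
  simp at h1
  simp [h1]

-- Up to a null set the event lies in the union of the finitely many atoms satisfying `Q`.
-- Subadditivity alone gives the bound, for an arbitrary predicate `Q`.
open Classical in
theorem measureReal_le_bernoulliExp [IsProbabilityMeasure P]
    (hy : ∀ i, HasLaw (fun ω => y ω i) (bernoulliMeasure (1 : ℝ) 0 ⟨μ i, hμ i⟩) P)
    (hind : iIndepFun (fun i ω => y ω i) P) (Q : (Fin n → ℝ) → Prop) :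
    P.real {ω | Q fun i => y ω i} ≤ bernoulliExp (fun i => μ i) (fun z => if Q z then 1 else 0) := by
  have hsub : {ω | Q fun i => y ω i} ⊆ {ω | ¬ ∀ i, y ω i = 0 ∨ y ω i = 1} ∪
      ⋃ b ∈ Finset.univ.filter (fun b : Fin n → Bool => Q (boolVec b)),
        {ω | ∀ i, y ω i = boolVec b i} := by
    intro ω hω
    by_cases h : ∀ i, y ω i = 0 ∨ y ω i = 1
    · right
      have hb : (fun i => y ω i) = boolVec fun i => decide (y ω i = 1) := by
        funext i
        rcases h i with h | h <;> simp [boolVec, h]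
      simp only [Set.mem_iUnion]
      refine ⟨fun i => decide (y ω i = 1), ?_, fun i => congrFun hb i⟩
      rw [Finset.mem_filter, ← hb]
      exact ⟨Finset.mem_univ _, hω⟩
    · exact Or.inl h
  refine (measureReal_mono hsub).trans ((measureReal_union_le _ _).trans ?_)
  rw [measureReal_not_boolVec hy, zero_add]
  refine (measureReal_biUnion_finset_le _ _).trans_eq ?_
  simp only [measureReal_eq_bernoulliWeight hy hind, bernoulliExp, Finset.sum_filter, mul_ite,
    mul_one, mul_zero]

end Law

/-! ### The oracle inequality. -/

theorem mainTheorem4 :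
    ∃ C : ℝ, 0 < C ∧
      ∀ (n : ℕ), 1 ≤ n →
      ∀ {Ω : Type*} [MeasurableSpace Ω] (P : Measure Ω) [IsProbabilityMeasure P]
        (μ : EuclideanSpace ℝ (Fin n)) (hμ : ∀ i, μ i ∈ unitInterval)
        (y μhat : Ω → EuclideanSpace ℝ (Fin n)),
        (∀ i, HasLaw (fun ω => y ω i) (bernoulliMeasure (1 : ℝ) 0 ⟨μ i, hμ i⟩) P) →
        iIndepFun (fun i ω => y ω i) P →
        (∀ ω, IsLeastSquares (isotonicBox n 0 1) (y ω) (μhat ω)) →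
        ∀ x : ℝ, 0 ≤ x →
          1 - Real.exp (-x) ≤
            P.real {ω | (1 / (n : ℝ)) * ‖μhat ω - μ‖ ^ 2 ≤
              minApproxError μ +
                ((C / (n : ℝ)) ^ (1 / 3 : ℝ) + Real.sqrt (2 * x / (n : ℝ))) ^ 2} := by
  obtain ⟨c, hc, hcrit⟩ := exists_critical_radius
  -- With `C = c³`, `(C/n)^(1/3) = c n^(-1/3) = t/√n` for `t = c n^(1/6)`.
  refine ⟨c ^ 3, by positivity, fun n hn Ω _ P _ μ hμ y μhat hy hind hls x hx => ?_⟩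
  have hn1 : (1 : ℝ) ≤ n := by exact_mod_cast hn
  have hn0 : (0 : ℝ) < n := by linarith
  set ν : ℝ := (n : ℝ) ^ (1 / 6 : ℝ) with hνdef
  have hν1 : 1 ≤ ν := Real.one_le_rpow hn1 (by norm_num)
  have hν0 : 0 < ν := by linarith
  have hν6 : ν ^ 6 = n := by
    rw [hνdef, ← Real.rpow_natCast, ← Real.rpow_mul hn0.le]
    norm_num
  obtain ⟨⟨u, hu, hmin⟩, -⟩ := minApproxError_isLeast μ
  set t := c * ν with htdef
  have ht : 0 < t := by positivity
  have hrate : (c ^ 3 / (n : ℝ)) ^ (1 / 3 : ℝ) = c / ν ^ 2 := by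
    rw [show c ^ 3 / (n : ℝ) = (c / ν ^ 2) ^ 3 by rw [← hν6]; ring, ← Real.rpow_natCast,
      ← Real.rpow_mul (by positivity)]
    norm_num
  have hn3 : √(n : ℝ) = ν ^ 3 := by
    rw [← hν6, show ν ^ 6 = (ν ^ 3) ^ 2 by ring, Real.sqrt_sq (by positivity)]
  have hfinal : ((c ^ 3 / (n : ℝ)) ^ (1 / 3 : ℝ) + √(2 * x / n)) ^ 2 =
      1 / (n : ℝ) * (t + √(2 * x)) ^ 2 := by
    rw [hrate, Real.sqrt_div (by positivity), hn3, ← hν6, htdef]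
    field_simp
  have htail := (measureReal_le_bernoulliExp hy hind _).trans
    (bernoulliExp_supportFun_tail hμ (localizedBox_nonempty hu ht.le) ht localizedBox_sq_le hx
      (hcrit n ν hν1 hν6 (fun i => μ i) hμ u hu))
  set good := {ω | (1 / (n : ℝ)) * ‖μhat ω - μ‖ ^ 2 ≤ minApproxError μ +
    ((c ^ 3 / (n : ℝ)) ^ (1 / 3 : ℝ) + √(2 * x / n)) ^ 2}
  set bad := {ω | t ^ 2 / 2 + t * √(2 * x) <
    supportFun (localizedBox u t) ((fun i => y ω i) - fun i => μ i)}
  -- A covering is enough: subadditivity gives `1 ≤ P good + P bad` without measurability of the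
  -- estimator.
  have hcover : (Set.univ : Set Ω) ⊆ good ∪ bad := by
    intro ω _
    by_cases hω : ω ∈ bad
    · exact Or.inr hω
    · left
      have hω' : supportFun (localizedBox u t) ((fun i => y ω i) - fun i => μ i) ≤
          t ^ 2 / 2 + t * √(2 * x) := not_lt.1 hω
      have hK := isotonicBox_convex n 0 1
      have h1 := (hls ω).norm_sub_sq_le hK hu μ
      have h2 := two_mul_inner_sub_sq_le hK (ξ := y ω - μ) hu (hls ω).1 ht
        (Real.sqrt_nonneg (2 * x)) fun w hw hwt => ?_
      · rw [Set.mem_ofPred_eq]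
        rw [hfinal, ← hmin]
        beta_reduce
        rw [← mul_add]
        exact mul_le_mul_of_nonneg_left (by linarith) (by positivity)
      · refine le_trans (le_of_eq ?_) ((le_supportFun ht.le localizedBox_sq_le _
          ⟨w, hw, hwt, rfl⟩).trans hω')
        rw [PiLp.inner_apply]
        exact Finset.sum_congr rfl fun i _ => by simp [mul_comm]
  have h1 := (measureReal_mono (μ := P) hcover).trans (measureReal_union_le _ _)
  rw [probReal_univ] at h1
  linarith
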